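/- All graphs are finite and simple, and a graph is planar if it can be drawn in the plane, with vertices as distinct points and edges as simple (continuous) arcs joining their endpoints, so that no two edges meet except at a vertex incident to both and no edge passes through a vertex other than its endpoints. For a connected graph $G$ with at least one edge let $\tau(G)$ be the number of spanning trees of $G$, for an edge $e$ let $\tau_G(e)$ be the number of spanning trees of $G$ that contain $e$, put $d_G(e)=\tau_G(e)/\tau(G)$, and let the spanning tree edge dependence of $G$ be $\mathrm{dep}(G)=\max_{e\in E(G)}d_G(e)$. Theorem. (i) Let $G$ be a connected planar graph on $n\ge 2$ vertices. Then $\mathrm{dep}(G)>\frac13$. (ii) Consequently, no rational number $r\le\frac13$ is the dependence of a connected planar graph on at least two vertices. (iii) In particular, Kahl's conjecture that for all positive integers $p<q$ there is a planar graph $G$ with $\mathrm{dep}(G)=p/q$ is false for simple planar graphs. -/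

import Mathlib

universe u

namespace SimpleGraph

variable {V : Type u}

/-- The spanning trees of `G`: a spanning subgraph of `G` has all of `V` as its vertex set, so it
is a graph `T` on `V` with `T ≤ G`. -/
def spanningTrees (G : SimpleGraph V) : Set (SimpleGraph V) :=
  {T | T ≤ G ∧ T.IsTree}

/-- The spanning trees of `G` that contain the edge `e`. -/
def spanningTreesThrough (G : SimpleGraph V) (e : Sym2 V) : Set (SimpleGraph V) :=
  {T | T ∈ G.spanningTrees ∧ e ∈ T.edgeSet}

/-- The number `τ(G)` of spanning trees of `G`. -/
noncomputable def numSpanningTrees (G : SimpleGraph V) : ℕ :=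
  G.spanningTrees.ncard

/-- The number `τ_G(e)` of spanning trees of `G` that contain the edge `e`. -/
noncomputable def numSpanningTreesThrough (G : SimpleGraph V) (e : Sym2 V) : ℕ :=
  (G.spanningTreesThrough e).ncard

/-- The spanning tree edge density `d_G(e) = τ_G(e) / τ(G)`. -/
noncomputable def spanningTreeDensity (G : SimpleGraph V) (e : Sym2 V) : ℝ :=
  (G.numSpanningTreesThrough e : ℝ) / (G.numSpanningTrees : ℝ)

/-- The spanning tree edge dependence `dep(G)`, the maximum of `d_G(e)` over the edges `e`
of `G`. -/
noncomputable def dep (G : SimpleGraph V) : ℝ :=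
  ⨆ e : G.edgeSet, G.spanningTreeDensity (e : Sym2 V)

/-- For a finite graph with at least one edge the supremum defining `dep` is a maximum. -/
theorem isGreatest_dep [Finite V] (G : SimpleGraph V) (h : G.edgeSet.Nonempty) :
    IsGreatest (G.spanningTreeDensity '' G.edgeSet) G.dep := by
  have hfin : (G.spanningTreeDensity '' G.edgeSet).Finite := (Set.toFinite G.edgeSet).image _
  have hdep : G.dep = sSup (G.spanningTreeDensity '' G.edgeSet) := by
    rw [sSup_image']
    rfl
  rw [hdep]
  exact ⟨(h.image _).csSup_mem hfin, fun x hx => le_csSup hfin.bddAbove hx⟩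

/-- A drawing of `G` in the Euclidean plane in which edges meet only at common endpoints:
the vertices are distinct points, every edge is a simple arc joining its two endpoints, an arc
passes through no vertex other than its endpoints, and any common point of two different arcs is
a vertex incident to both edges. -/
structure PlaneDrawing (G : SimpleGraph V) where
  point : V → EuclideanSpace ℝ (Fin 2)
  point_injective : Function.Injective point
  arc : G.edgeSet → unitInterval → EuclideanSpace ℝ (Fin 2)
  arc_continuous : ∀ e, Continuous (arc e)
  arc_injective : ∀ e, Function.Injective (arc e)
  arc_ends : ∀ e : G.edgeSet, s(arc e 0, arc e 1) = (e : Sym2 V).map point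
  incident_of_point_mem_arc : ∀ (e : G.edgeSet) (v : V),
    point v ∈ Set.range (arc e) → v ∈ (e : Sym2 V)
  common_vertex_of_mem_arcs : ∀ e f : G.edgeSet, e ≠ f →
    ∀ x ∈ Set.range (arc e) ∩ Set.range (arc f),
      ∃ v : V, v ∈ (e : Sym2 V) ∧ v ∈ (f : Sym2 V) ∧ point v = x

/-- A graph is planar if it can be drawn in the plane without crossings. -/
def IsPlanar (G : SimpleGraph V) : Prop :=
  Nonempty G.PlaneDrawing

end SimpleGraph

/-- The number `r` is the dependence of some finite simple connected planar graph with at least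
one edge (for a connected graph: with at least two vertices). -/
def IsPlanarDependence (r : ℝ) : Prop :=
  ∃ (V : Type u) (_ : Fintype V) (G : SimpleGraph V),
    2 ≤ Fintype.card V ∧ G.Connected ∧ G.IsPlanar ∧ G.dep = r

/-!
Every spanning tree has `n - 1` edges, so the mean of `d_G(e)` over the edges of `G` is
`(n - 1) / |E|`, and `dep G ≤ 1 / 3` forces `|E| ≥ 3 (n - 1)`. So many edges force a `K₅` minor.
To see this, keep exactly `c (n - 1)` edges (with `c = 3`); then some vertex `v` has degree less
than `2 c`. If `v` has degree at most `c`, delete it; if an edge at `v` lies in fewer than `c`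
triangles, contract it; in both cases at most `c` edges and one vertex are lost. Otherwise `v` has
more than `c` neighbours, among which the minimum degree is at least `c`, and it suffices to find
`K₄` as a minor in that neighbourhood. Its `m ≤ 5` vertices span at least `3 m / 2`,
hence at least `2 (m - 1)` edges, so this is the same problem with `c = 2`, for which the
neighbourhood is a triangle.

A planar graph has no `K₅` minor: in a drawing, paths through the branch sets would give a drawing
of `K₅` in which edges without a common end are disjoint. For disjoint arcs `α`, `β` the function
`α s - β t` has a continuous logarithm on the square, and comparing its increments along the two
ways around the square gives a linear relation between the angles swept by one arc seen from the
ends of the other. These relations show that a triangle winds equally often around the other two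
points, and that for four of the points the alternating sum of the winding numbers of the four
triangles around their fourth points is odd. In the alternating sum over the five choices of four
points the winding numbers cancel, but a sum of five odd numbers is not zero.
-/

open SimpleGraph Function

namespace SpanningTreeDependence

section LogIncrement

open Complex

theorem exists_continuous_exp_eq {X : Type*} [TopologicalSpace X] [SimplyConnectedSpace X]
    [LocallyPathConnectedSpace X] {f : X → ℂ} (hf : Continuous f) (h0 : ∀ x, f x ≠ 0) :
    ∃ F : X → ℂ, Continuous F ∧ ∀ x, exp (F x) = f x := by
  obtain ⟨x₀⟩ : Nonempty X := inferInstance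
  obtain ⟨F, ⟨-, hF⟩, -⟩ := isCoveringMapOn_exp.existsUnique_continuousMap_lifts ⟨f, hf⟩
    (a₀ := x₀) (e₀ := log (f x₀)) (by simp [exp_log (h0 x₀)]) (fun x => by simp [h0 x])
  exact ⟨F, F.continuous, fun x => congrFun hF x⟩

theorem sub_eq_sub_of_exp_eq_exp {X : Type*} [TopologicalSpace X] [PreconnectedSpace X]
    {F G : X → ℂ} (hF : Continuous F) (hG : Continuous G) (h : ∀ x, exp (F x) = exp (G x))
    (x y : X) : F x - F y = G x - G y := by
  have heq : (fun z => F z - F y + G y) = G := isCoveringMap_exp.eq_of_comp_eq (by fun_prop) hG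
    (funext fun z => Subtype.ext (by simp [exp_add, exp_sub, h])) y (by simp)
  linear_combination congrFun heq x

/-- The change `F 1 - F 0` of a continuous logarithm `F` of `f` along the unit interval. It does
not depend on `F`, and gets the junk value `0` if `f` has no continuous logarithm. -/
noncomputable def logIncrement (f : unitInterval → ℂ) : ℂ :=
  open Classical in
  if h : ∃ F : unitInterval → ℂ, Continuous F ∧ ∀ t, exp (F t) = f t then
    h.choose 1 - h.choose 0
  else 0

variable {f : unitInterval → ℂ}

theorem logIncrement_eq {F : unitInterval → ℂ} (hF : Continuous F) (h : ∀ t, exp (F t) = f t) :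
    logIncrement f = F 1 - F 0 := by
  have hex : ∃ F : unitInterval → ℂ, Continuous F ∧ ∀ t, exp (F t) = f t := ⟨F, hF, h⟩
  rw [logIncrement, dif_pos hex]
  exact sub_eq_sub_of_exp_eq_exp hex.choose_spec.1 hF
    (fun t => (hex.choose_spec.2 t).trans (h t).symm) 1 0

instance : ContractibleSpace unitInterval :=
  (convex_Icc 0 1).contractibleSpace ⟨0, unitInterval.zero_mem⟩

instance : LocallyPathConnectedSpace unitInterval :=
  (convex_Icc (0 : ℝ) 1).locallyPathConnectedSpace

theorem exp_logIncrement (hf : Continuous f) (h0 : ∀ t, f t ≠ 0) :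
    exp (logIncrement f) = f 1 / f 0 := by
  obtain ⟨F, hF, hFf⟩ := exists_continuous_exp_eq hf h0
  rw [logIncrement_eq hF hFf, exp_sub, hFf, hFf]

theorem logIncrement_neg (hf : Continuous f) (h0 : ∀ t, f t ≠ 0) :
    logIncrement (fun t => -f t) = logIncrement f := by
  obtain ⟨F, hF, hFf⟩ := exists_continuous_exp_eq hf h0
  rw [logIncrement_eq hF hFf, logIncrement_eq (F := fun t => F t + Real.pi * I) (by fun_prop)
    (fun t => by simp [exp_add, hFf]), add_sub_add_right_eq_sub]

theorem logIncrement_square {f : unitInterval × unitInterval → ℂ} (hf : Continuous f)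
    (h0 : ∀ x, f x ≠ 0) :
    logIncrement (fun s => f (s, 0)) + logIncrement (fun t => f (1, t)) =
      logIncrement (fun t => f (0, t)) + logIncrement (fun s => f (s, 1)) := by
  obtain ⟨F, hF, hFf⟩ := exists_continuous_exp_eq hf h0
  rw [logIncrement_eq (F := fun s => F (s, 0)) (by fun_prop) (fun _ => hFf _),
    logIncrement_eq (F := fun t => F (1, t)) (by fun_prop) (fun _ => hFf _),
    logIncrement_eq (F := fun t => F (0, t)) (by fun_prop) (fun _ => hFf _),
    logIncrement_eq (F := fun s => F (s, 1)) (by fun_prop) (fun _ => hFf _)]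
  ring

end LogIncrement

section AlmostEmbedding

open Complex

variable {ι : Type*} {p : ι → ℂ} {γ : ∀ i j, Path (p i) (p j)}

/-- A drawing of the complete graph on `ι` in the plane is an almost embedding if any two edges
without a common end are disjoint. The trivial edges `i = j` are included, so that the points are
distinct and no edge passes through a point that is not one of its ends. -/
def IsAlmostEmbedding (γ : ∀ i j, Path (p i) (p j)) : Prop :=
  ∀ i j k l, i ≠ k → i ≠ l → j ≠ k → j ≠ l → ∀ s t, γ i j s ≠ γ k l t

/-- The change of a continuous logarithm of `z - p k` as `z` runs along the edge from `p i`
to `p j`; its imaginary part is the angle swept out as seen from `p k`. -/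
noncomputable def edgeLogIncrement (γ : ∀ i j, Path (p i) (p j)) (i j k : ι) : ℂ :=
  logIncrement fun t => γ i j t - p k

/-- The change of a continuous logarithm of `z - p l` as `z` runs around the triangle `i j k`;
up to the factor `2πi`, this is the winding number of the triangle around `p l`. -/
noncomputable def triangleLogIncrement (γ : ∀ i j, Path (p i) (p j)) (i j k l : ι) : ℂ :=
  edgeLogIncrement γ i j l + edgeLogIncrement γ j k l - edgeLogIncrement γ i k l

namespace IsAlmostEmbedding

variable (hγ : IsAlmostEmbedding γ) {i j k l m : ι}
include hγ

theorem point_ne (hij : i ≠ j) : p i ≠ p j := by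
  simpa using hγ i i j j hij hij hij hij 0 0

theorem path_ne_point (hik : i ≠ k) (hjk : j ≠ k) (t : unitInterval) : γ i j t ≠ p k := by
  simpa using hγ i j k k hik hik hjk hjk t 0

theorem exp_edgeLogIncrement (hik : i ≠ k) (hjk : j ≠ k) :
    exp (edgeLogIncrement γ i j k) = (p j - p k) / (p i - p k) := by
  rw [edgeLogIncrement, exp_logIncrement (by fun_prop)
    (fun t => sub_ne_zero.2 (hγ.path_ne_point hik hjk t)), Path.target, Path.source]

theorem edgeLogIncrement_add (hik : i ≠ k) (hil : i ≠ l) (hjk : j ≠ k) (hjl : j ≠ l) :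
    edgeLogIncrement γ i j k + edgeLogIncrement γ k l j =
      edgeLogIncrement γ k l i + edgeLogIncrement γ i j l := by
  have hreverse {x : ι} (hkx : k ≠ x) (hlx : l ≠ x) :
      edgeLogIncrement γ k l x = logIncrement fun t => p x - γ k l t := by
    rw [edgeLogIncrement, ← logIncrement_neg (by fun_prop)
      (fun t => sub_ne_zero.2 (hγ.path_ne_point hkx hlx t))]
    simp only [neg_sub]
  rw [hreverse hik.symm hil.symm, hreverse hjk.symm hjl.symm]
  simpa [edgeLogIncrement] using logIncrement_square (f := fun x => γ i j x.1 - γ k l x.2)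
    (by fun_prop) (fun x => sub_ne_zero.2 (hγ i j k l hik hil hjk hjl x.1 x.2))

theorem triangleLogIncrement_eq (hil : i ≠ l) (hjl : j ≠ l) (hkl : k ≠ l) (him : i ≠ m)
    (hjm : j ≠ m) (hkm : k ≠ m) :
    triangleLogIncrement γ i j k l = triangleLogIncrement γ i j k m := by
  unfold triangleLogIncrement
  linear_combination hγ.edgeLogIncrement_add hil him hjl hjm +
    hγ.edgeLogIncrement_add hjl hjm hkl hkm - hγ.edgeLogIncrement_add hil him hkl hkm

theorem exists_exp_eq_neg_one (hij : i ≠ j) (hik : i ≠ k) (hil : i ≠ l) (hjk : j ≠ k)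
    (hjl : j ≠ l) (hkl : k ≠ l) :
    ∃ z, exp z = -1 ∧ triangleLogIncrement γ i j k l - triangleLogIncrement γ i j l k +
      triangleLogIncrement γ i k l j - triangleLogIncrement γ j k l i = 2 * z := by
  refine ⟨edgeLogIncrement γ k l j - edgeLogIncrement γ k l i + (edgeLogIncrement γ i l k -
    edgeLogIncrement γ i l j) + (edgeLogIncrement γ j l i - edgeLogIncrement γ j l k), ?_, ?_⟩
  · rw [exp_add, exp_add, exp_sub, exp_sub, exp_sub, hγ.exp_edgeLogIncrement hjk.symm hjl.symm,
      hγ.exp_edgeLogIncrement hik.symm hil.symm, hγ.exp_edgeLogIncrement hik hkl.symm,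
      hγ.exp_edgeLogIncrement hij hjl.symm, hγ.exp_edgeLogIncrement hij.symm hil.symm,
      hγ.exp_edgeLogIncrement hjk hkl.symm]
    have hne {x y : ι} (hxy : x ≠ y) : p x - p y ≠ 0 := sub_ne_zero.2 (hγ.point_ne hxy)
    field_simp [hne hij, hne hij.symm, hne hik, hne hik.symm, hne hil, hne hil.symm, hne hjk,
      hne hjk.symm, hne hjl, hne hjl.symm, hne hkl, hne hkl.symm]
    ring
  · unfold triangleLogIncrement
    linear_combination -hγ.edgeLogIncrement_add hik hil hjk hjl -
      hγ.edgeLogIncrement_add hij.symm hjl hik.symm hkl +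
      hγ.edgeLogIncrement_add hij hil hjk.symm hkl

end IsAlmostEmbedding

theorem not_isAlmostEmbedding_fin_five {p : Fin 5 → ℂ} (γ : ∀ i j, Path (p i) (p j)) :
    ¬ IsAlmostEmbedding γ := by
  intro hγ
  have hK4 (i j k l : Fin 5) (h : i < j ∧ j < k ∧ k < l) :=
    hγ.exists_exp_eq_neg_one h.1.ne (h.1.trans h.2.1).ne ((h.1.trans h.2.1).trans h.2.2).ne
      h.2.1.ne (h.2.1.trans h.2.2).ne h.2.2.ne
  have hT (i j k l m : Fin 5) (hl : i ≠ l ∧ j ≠ l ∧ k ≠ l) (hm : i ≠ m ∧ j ≠ m ∧ k ≠ m) :=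
    hγ.triangleLogIncrement_eq hl.1 hl.2.1 hl.2.2 hm.1 hm.2.1 hm.2.2
  obtain ⟨z₀, h₀, hz₀⟩ := hK4 1 2 3 4 (by decide)
  obtain ⟨z₁, h₁, hz₁⟩ := hK4 0 2 3 4 (by decide)
  obtain ⟨z₂, h₂, hz₂⟩ := hK4 0 1 3 4 (by decide)
  obtain ⟨z₃, h₃, hz₃⟩ := hK4 0 1 2 4 (by decide)
  obtain ⟨z₄, h₄, hz₄⟩ := hK4 0 1 2 3 (by decide)
  have hsum : z₀ - z₁ + z₂ - z₃ + z₄ = 0 := by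
    linear_combination (-hz₀ + hz₁ - hz₂ + hz₃ - hz₄ +
      hT 0 1 2 3 4 (by decide) (by decide) - hT 0 1 3 2 4 (by decide) (by decide) +
      hT 0 2 3 1 4 (by decide) (by decide) - hT 1 2 3 0 4 (by decide) (by decide) +
      hT 0 1 4 2 3 (by decide) (by decide) - hT 0 2 4 1 3 (by decide) (by decide) +
      hT 1 2 4 0 3 (by decide) (by decide) + hT 0 3 4 1 2 (by decide) (by decide) -
      hT 1 3 4 0 2 (by decide) (by decide) + hT 2 3 4 0 1 (by decide) (by decide)) / 2
  have := congrArg exp hsum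
  simp only [exp_add, exp_sub, h₀, h₁, h₂, h₃, h₄, exp_zero] at this
  norm_num at this

end AlmostEmbedding

variable {V W U : Type*}

section Minor

variable {G : SimpleGraph V} {H : SimpleGraph W} {K : SimpleGraph U}

/-- `H` is a minor of `G`: the vertices of `H` can be represented by disjoint connected branch
sets of vertices of `G` such that the branch sets of adjacent vertices are joined by an edge. -/
def IsMinor (H : SimpleGraph W) (G : SimpleGraph V) : Prop :=
  ∃ B : W → Set V, (∀ x, (G.induce (B x)).Connected) ∧ Pairwise (Disjoint on B) ∧
    ∀ x y, H.Adj x y → ∃ a ∈ B x, ∃ b ∈ B y, G.Adj a b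

theorem connected_induce_biUnion {B : W → Set V} (hB : ∀ x, (G.induce (B x)).Connected)
    (hadj : ∀ x y, H.Adj x y → ∃ a ∈ B x, ∃ b ∈ B y, G.Adj a b) {S : Set W}
    (hS : (H.induce S).Connected) : (G.induce (⋃ x ∈ S, B x)).Connected := by
  have hsub (x : S) : B x ⊆ ⋃ x ∈ S, B x := Set.subset_biUnion_of_mem x.2
  have hbranch (x : S) (a b : B x) : (G.induce (⋃ x ∈ S, B x)).Reachable
      (Set.inclusion (hsub x) a) (Set.inclusion (hsub x) b) :=
    ((hB x).preconnected a b).map (induceHomOfLE G (hsub x)).toHom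
  have hwalk (x y : S) (p : (H.induce S).Walk x y) (a : B x) (b : B y) :
      (G.induce (⋃ x ∈ S, B x)).Reachable
        (Set.inclusion (hsub x) a) (Set.inclusion (hsub y) b) := by
    induction p with
    | nil => exact hbranch _ a b
    | cons hxz _ ih =>
      obtain ⟨c, hc, d, hd, hcd⟩ := hadj _ _ hxz
      have hedge : (G.induce (⋃ x ∈ S, B x)).Adj ⟨c, hsub _ hc⟩ ⟨d, hsub _ hd⟩ := hcd
      exact ((hbranch _ a ⟨c, hc⟩).trans hedge.reachable).trans (ih ⟨d, hd⟩ b)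
  obtain ⟨x₀⟩ := hS.nonempty
  obtain ⟨a₀⟩ := (hB x₀).nonempty
  refine (connected_iff_exists_forall_reachable _).2 ⟨Set.inclusion (hsub x₀) a₀, ?_⟩
  rintro ⟨b, hb⟩
  obtain ⟨y, hy, hby⟩ := Set.mem_iUnion₂.1 hb
  obtain ⟨p⟩ := hS.preconnected x₀ ⟨y, hy⟩
  exact hwalk x₀ ⟨y, hy⟩ p a₀ ⟨b, hby⟩

theorem IsMinor.trans (hKH : IsMinor K H) (hHG : IsMinor H G) : IsMinor K G := by
  obtain ⟨B, hB, hBdisj, hBadj⟩ := hKH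
  obtain ⟨C, hC, hCdisj, hCadj⟩ := hHG
  refine ⟨fun x => ⋃ y ∈ B x, C y, fun x => connected_induce_biUnion hC hCadj (hB x), ?_, ?_⟩
  · refine fun x x' hx => Set.disjoint_iUnion₂_left.2 fun y hy => Set.disjoint_iUnion₂_right.2
      fun y' hy' => hCdisj ?_
    rintro rfl
    exact Set.disjoint_left.1 (hBdisj hx) hy hy'
  · intro x x' hx
    obtain ⟨y, hy, y', hy', hyy'⟩ := hBadj x x' hx
    obtain ⟨a, ha, b, hb, hab⟩ := hCadj y y' hyy'
    exact ⟨a, Set.mem_biUnion hy ha, b, Set.mem_biUnion hy' hb, hab⟩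

theorem IsMinor.of_isContained (h : H ⊑ G) : IsMinor H G := by
  obtain ⟨f⟩ := h
  refine ⟨fun x => {f x}, fun x => ?_, fun x y hxy => ?_, fun x y hxy => ?_⟩
  · have : Subsingleton ({f x} : Set V) := inferInstance
    exact .of_subsingleton
  · simpa using f.injective.ne hxy
  · exact ⟨f x, rfl, f y, rfl, f.toHom.map_adj hxy⟩

theorem isMinor_map {φ : V → W} (hφ : ∀ x, (G.induce (φ ⁻¹' {x})).Connected) :
    IsMinor (G.map φ) G := by
  refine ⟨fun x => φ ⁻¹' {x}, hφ, fun x y hxy => ?_, fun x y hxy => ?_⟩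
  · exact (Set.disjoint_singleton.2 hxy).preimage φ
  · obtain ⟨-, a, b, hab, ha, hb⟩ := (map_adj' φ G x y).1 hxy
    exact ⟨a, ha, b, hb, hab⟩

theorem connected_induce_image_val {S : Set V} {T : Set S}
    (h : ((G.induce S).induce T).Connected) : (G.induce (Subtype.val '' T)).Connected := by
  let f : (G.induce S).induce T →g G.induce (Subtype.val '' T) :=
    { toFun := fun x => ⟨x, x, x.2, rfl⟩
      map_rel' := id }
  refine h.map f ?_
  rintro ⟨_, x, hx, rfl⟩
  exact ⟨⟨x, hx⟩, rfl⟩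

theorem isMinor_top_fin_succ {k : ℕ} {v : V}
    (h : IsMinor (⊤ : SimpleGraph (Fin k)) (G.induce (G.neighborSet v))) :
    IsMinor (⊤ : SimpleGraph (Fin (k + 1))) G := by
  obtain ⟨B, hB, hBdisj, hBadj⟩ := h
  have hv (i : Fin k) : v ∉ Subtype.val '' B i := by
    rintro ⟨w, -, hw⟩
    exact G.ne_of_adj w.2 hw.symm
  have hdisj {i j : Fin k} (hij : i ≠ j) :
      Disjoint (Subtype.val '' B i) (Subtype.val '' B j) :=
    (Set.disjoint_image_iff Subtype.val_injective).2 (hBdisj hij)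
  have hadj (i : Fin k) : ∃ b ∈ Subtype.val '' B i, G.Adj v b := by
    obtain ⟨b, hb⟩ := (hB i).nonempty
    exact ⟨b, ⟨b, hb, rfl⟩, b.2⟩
  refine ⟨Fin.cons {v} fun i => Subtype.val '' B i, Fin.cases ?_ fun i => ?_,
    Fin.cases (Fin.cases ?_ fun j _ => ?_) fun i => Fin.cases (fun _ => ?_) fun j hij => ?_,
    Fin.cases (Fin.cases ?_ fun j _ => ?_) fun i => Fin.cases (fun _ => ?_) fun j hij => ?_⟩
  · exact (Connected.of_subsingleton : (G.induce {v}).Connected)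
  · exact connected_induce_image_val (hB i)
  · exact fun h => absurd rfl h
  · exact Set.disjoint_singleton_left.2 (hv j)
  · exact Set.disjoint_singleton_right.2 (hv i)
  · exact hdisj (by simpa using hij)
  · simp
  · simpa using hadj j
  · obtain ⟨b, hb, hvb⟩ := hadj i
    exact ⟨b, hb, v, rfl, hvb.symm⟩
  · obtain ⟨a, ha, b, hb, hab⟩ := hBadj i j (by simpa using hij)
    exact ⟨a, ⟨a, ha, rfl⟩, b, ⟨b, hb, rfl⟩, hab⟩

end Minor

section PlaneDrawing

variable {G : SimpleGraph V}

/-- The part of a plane drawing that consists of the points of `S` and of the edges with both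
ends in `S`. -/
def carrier (D : G.PlaneDrawing) (S : Set V) : Set (EuclideanSpace ℝ (Fin 2)) :=
  D.point '' S ∪ ⋃ e : {e : G.edgeSet // ∀ v ∈ (e : Sym2 V), v ∈ S}, Set.range (D.arc e)

theorem disjoint_carrier (D : G.PlaneDrawing) {S T : Set V} (h : Disjoint S T) :
    Disjoint (carrier D S) (carrier D T) := by
  rw [Set.disjoint_left] at h ⊢
  rintro x (⟨v, hv, rfl⟩ | hx) (⟨w, hw, hvw⟩ | hy)
  · exact h hv (D.point_injective hvw ▸ hw)
  · obtain ⟨⟨f, hf⟩, hxf⟩ := Set.mem_iUnion.1 hy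
    exact h hv (hf _ (D.incident_of_point_mem_arc f v hxf))
  · obtain ⟨⟨e, he⟩, hxe⟩ := Set.mem_iUnion.1 hx
    exact h (he _ (D.incident_of_point_mem_arc e w (hvw ▸ hxe))) hw
  · obtain ⟨⟨e, he⟩, hxe⟩ := Set.mem_iUnion.1 hx
    obtain ⟨⟨f, hf⟩, hxf⟩ := Set.mem_iUnion.1 hy
    have hef : e ≠ f := by
      rintro rfl
      have hend := Sym2.out_fst_mem (e : Sym2 V)
      exact h (he _ hend) (hf _ hend)
    obtain ⟨v, hve, hvf, -⟩ := D.common_vertex_of_mem_arcs e f hef x ⟨hxe, hxf⟩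
    exact h (he v hve) (hf v hvf)

theorem joinedIn_carrier_of_adj (D : G.PlaneDrawing) {S : Set V} {a b : S}
    (hab : (G.induce S).Adj a b) : JoinedIn (carrier D S) (D.point a) (D.point b) := by
  let e : G.edgeSet := ⟨s(↑a, ↑b), hab⟩
  have he : ∀ v ∈ (e : Sym2 V), v ∈ S := by simp [e]
  have harc : JoinedIn (carrier D S) (D.arc e 0) (D.arc e 1) :=
    ⟨⟨⟨D.arc e, D.arc_continuous e⟩, rfl, rfl⟩,
      fun t => Or.inr (Set.mem_iUnion.2 ⟨⟨e, he⟩, t, rfl⟩)⟩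
  rcases Sym2.eq_iff.1 (D.arc_ends e) with ⟨h0, h1⟩ | ⟨h0, h1⟩
  · rwa [← h0, ← h1]
  · rw [← h0, ← h1]
    exact harc.symm

theorem joinedIn_carrier_of_reachable (D : G.PlaneDrawing) {S : Set V} {a b : S}
    (hab : (G.induce S).Reachable a b) : JoinedIn (carrier D S) (D.point a) (D.point b) := by
  obtain ⟨p⟩ := hab
  induction p with
  | nil => exact JoinedIn.refl (Or.inl ⟨_, Subtype.prop _, rfl⟩)
  | cons h _ ih => exact (joinedIn_carrier_of_adj D h).trans ih

theorem not_isMinor_top_fin_five_of_isPlanar (hG : G.IsPlanar) :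
    ¬ IsMinor (⊤ : SimpleGraph (Fin 5)) G := by
  rintro ⟨B, hB, hBdisj, hBadj⟩
  obtain ⟨D⟩ := hG
  choose v hv using fun i => Set.nonempty_coe_sort.1 (hB i).nonempty
  have hpair (i j : Fin 5) : (G.induce (B i ∪ B j)).Connected := by
    rcases eq_or_ne i j with rfl | hij
    · rw [Set.union_self]
      exact hB i
    · obtain ⟨a, ha, b, hb, hab⟩ := hBadj i j hij
      exact connected_induce_union (hB i).preconnected (hB j).preconnected ha hb hab
  have hjoin (i j : Fin 5) :
      JoinedIn (carrier D (B i ∪ B j)) (D.point (v i)) (D.point (v j)) :=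
    joinedIn_carrier_of_reachable D
      ((hpair i j).preconnected ⟨v i, Or.inl (hv i)⟩ ⟨v j, Or.inr (hv j)⟩)
  let φ := Complex.orthonormalBasisOneI.repr.symm
  refine not_isAlmostEmbedding_fin_five
    (fun i j => (hjoin i j).somePath.map φ.continuous) fun i j k l hik hil hjk hjl s t hst => ?_
  have hdisj : Disjoint (B i ∪ B j) (B k ∪ B l) := by
    simp only [Set.disjoint_union_left, Set.disjoint_union_right]
    exact ⟨⟨hBdisj hik, hBdisj hjk⟩, hBdisj hil, hBdisj hjl⟩
  exact (disjoint_carrier D hdisj).ne_of_mem ((hjoin i j).somePath_mem s)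
    ((hjoin k l).somePath_mem t) (φ.injective hst)

end PlaneDrawing

section Contraction

variable {G : SimpleGraph V} {u v : V} {φ : V → W}

theorem isMinor_map_of_adj (hφ : Surjective φ)
    (hinj : ∀ a b, φ a = φ b → a = b ∨ s(a, b) = s(u, v)) (huv : G.Adj u v) :
    IsMinor (G.map φ) G := by
  refine isMinor_map fun x => ?_
  obtain ⟨a, ha⟩ := hφ x
  have : Nonempty (φ ⁻¹' {x}) := ⟨a, ha⟩
  refine ⟨fun ⟨b, hb⟩ ⟨c, hc⟩ => ?_⟩
  rcases hinj b c (hb.trans hc.symm) with rfl | hbc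
  · rfl
  · have hadj : (G.induce (φ ⁻¹' {x})).Adj ⟨b, hb⟩ ⟨c, hc⟩ := by
      rwa [comap_adj, ← mem_edgeSet, Embedding.subtype_apply, Embedding.subtype_apply, hbc]
    exact hadj.reachable

-- When `u` and `v` are merged, each common neighbour `w` makes `uw` and `vw` parallel.
theorem injOn_sym2Map_edgeSet_diff (hinj : ∀ a b, φ a = φ b → a = b ∨ s(a, b) = s(u, v)) :
    Set.InjOn (Sym2.map φ) (G.edgeSet \ (s(u, ·)) '' insert v (G.commonNeighbors u v)) := by
  set kept := G.edgeSet \ (s(u, ·)) '' insert v (G.commonNeighbors u v)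
  have hne {a b : V} (hab : s(a, b) ∈ kept) : s(a, b) ≠ s(u, v) :=
    fun h => hab.2 ⟨v, Or.inl rfl, h.symm⟩
  have hne_of_common {a b d : V} (hab : s(a, b) ∈ kept) (had : s(a, d) ∈ kept) :
      s(b, d) ≠ s(u, v) := by
    intro h
    rcases Sym2.eq_iff.1 h with ⟨rfl, rfl⟩ | ⟨rfl, rfl⟩
    · exact hab.2 ⟨a, Or.inr ⟨hab.1.symm, had.1.symm⟩, Sym2.eq_swap⟩
    · exact had.2 ⟨a, Or.inr ⟨had.1.symm, hab.1.symm⟩, Sym2.eq_swap⟩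
  have heq {a b c d : V} (hab : s(a, b) ∈ kept) (hcd : s(c, d) ∈ kept) (hac : φ a = φ c)
      (hbd : φ b = φ d) : s(a, b) = s(c, d) := by
    rcases hinj a c hac with rfl | hac' <;> rcases hinj b d hbd with rfl | hbd'
    · rfl
    · exact absurd hbd' (hne_of_common hab hcd)
    · rw [Sym2.eq_swap] at hab hcd
      exact absurd hac' (hne_of_common hab hcd)
    · rcases Sym2.eq_iff.1 hac' with ⟨rfl, rfl⟩ | ⟨rfl, rfl⟩ <;>
        rcases Sym2.eq_iff.1 hbd' with ⟨rfl, rfl⟩ | ⟨rfl, rfl⟩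
      exacts [(G.irrefl hab.1).elim, (hne hab rfl).elim, (hne hab Sym2.eq_swap).elim,
        (G.irrefl hab.1).elim]
  rintro ⟨a, b⟩ hab ⟨c, d⟩ hcd h
  rcases Sym2.eq_iff.1 h with ⟨hac, hbd⟩ | ⟨had, hbc⟩
  · exact heq hab hcd hac hbd
  · have hdc : s(d, c) ∈ kept := Sym2.eq_swap ▸ hcd
    exact (heq hab hdc had hbc).trans Sym2.eq_swap

theorem ncard_edgeSet_le_ncard_edgeSet_map_add [Finite V] [Finite W]
    (hinj : ∀ a b, φ a = φ b → a = b ∨ s(a, b) = s(u, v)) :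
    G.edgeSet.ncard ≤ (G.map φ).edgeSet.ncard + 1 + (G.commonNeighbors u v).ncard := by
  let lost : Set (Sym2 V) := (s(u, ·)) '' insert v (G.commonNeighbors u v)
  have hmaps : Set.MapsTo (Sym2.map φ) (G.edgeSet \ lost) (G.map φ).edgeSet := by
    rintro ⟨a, b⟩ ⟨hab, hlost⟩
    refine map_adj_apply' hab fun h => ?_
    rcases hinj a b h with rfl | hab'
    · exact G.irrefl hab
    · exact hlost ⟨v, Or.inl rfl, hab'.symm⟩
  have hkept : (G.edgeSet \ lost).ncard ≤ (G.map φ).edgeSet.ncard :=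
    Set.ncard_le_ncard_of_injOn _ hmaps (injOn_sym2Map_edgeSet_diff hinj)
  have hlost : lost.ncard ≤ (G.commonNeighbors u v).ncard + 1 :=
    (Set.ncard_image_le (Set.toFinite _)).trans (Set.ncard_insert_le _ _)
  have := Set.ncard_le_ncard_sdiff_add_ncard G.edgeSet lost
  lia

theorem exists_isMinor_contract [Finite V] (huv : G.Adj u v) :
    ∃ H : SimpleGraph ({u}ᶜ : Set V), IsMinor H G ∧
      G.edgeSet.ncard ≤ H.edgeSet.ncard + 1 + (G.commonNeighbors u v).ncard := by
  classical
  let φ (a : V) : ({u}ᶜ : Set V) := if ha : a = u then ⟨v, huv.ne'⟩ else ⟨a, ha⟩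
  have hφ : Surjective φ := fun ⟨a, ha⟩ => ⟨a, dif_neg ha⟩
  have hinj (a b : V) (hab : φ a = φ b) : a = b ∨ s(a, b) = s(u, v) := by
    grind
  exact ⟨G.map φ, isMinor_map_of_adj hφ hinj huv, ncard_edgeSet_le_ncard_edgeSet_map_add hinj⟩

end Contraction

section Extremal

theorem sum_ncard_neighborSet [Fintype V] (G : SimpleGraph V) :
    ∑ v, (G.neighborSet v).ncard = 2 * G.edgeSet.ncard := by
  classical
  simp only [← coe_neighborFinset, ← coe_edgeFinset, Set.ncard_coe_finset,
    card_neighborFinset_eq_degree, sum_degrees_eq_twice_card_edges]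

theorem ncard_edgeSet_induce_compl_singleton_add [Finite V] (G : SimpleGraph V) (u : V) :
    (G.induce {u}ᶜ).edgeSet.ncard + (G.neighborSet u).ncard = G.edgeSet.ncard := by
  classical
  have := Fintype.ofFinite V
  simp only [← coe_neighborFinset, ← coe_edgeFinset, Set.ncard_coe_finset,
    card_neighborFinset_eq_degree, card_edgeFinset_induce_compl_singleton,
    card_edgeFinset_deleteIncidenceSet]
  exact Nat.sub_add_cancel (G.degree_le_card_edgeFinset u)

theorem ncard_edgeSet_le_choose_two [Finite V] (G : SimpleGraph V) :
    G.edgeSet.ncard ≤ (Nat.card V).choose 2 := by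
  classical
  have := Fintype.ofFinite V
  simpa only [← coe_edgeFinset, Set.ncard_coe_finset, Nat.card_eq_fintype_card] using
    G.card_edgeFinset_le_card_choose_two

theorem exists_le_ncard_edgeSet_eq (G : SimpleGraph V) {m : ℕ} (hm : m ≤ G.edgeSet.ncard) :
    ∃ H ≤ G, H.edgeSet.ncard = m := by
  obtain ⟨S, hS, rfl⟩ := Set.exists_subset_card_eq hm
  have hdiag : S \ Sym2.diagSet = S := sdiff_eq_left.2 <|
    Set.disjoint_left.2 fun e he hdiag => G.not_isDiag_of_mem_edgeSet (hS he) hdiag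
  refine ⟨fromEdgeSet S, (fromEdgeSet_le _).2 (Set.sdiff_subset.trans hS), ?_⟩
  rw [edgeSet_fromEdgeSet, hdiag]

theorem exists_isMinor_or_le_ncard_commonNeighbors [Finite V] (G : SimpleGraph V) (c : ℕ)
    (v : V) :
    (∃ (u : V) (H : SimpleGraph ({u}ᶜ : Set V)), IsMinor H G ∧
      G.edgeSet.ncard ≤ H.edgeSet.ncard + c) ∨
    (c < (G.neighborSet v).ncard ∧ ∀ u, G.Adj v u → c ≤ (G.commonNeighbors v u).ncard) := by
  by_contra! ⟨hminor, hlocal⟩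
  have hdeg : c < (G.neighborSet v).ncard := by
    have := hminor v _ (.of_isContained ⟨Copy.induce G {v}ᶜ⟩)
    have := ncard_edgeSet_induce_compl_singleton_add G v
    lia
  obtain ⟨u, hvu, hu⟩ := hlocal hdeg
  obtain ⟨H, hH, hE⟩ := exists_isMinor_contract hvu
  have := hminor v H hH
  lia

theorem ncard_neighborSet_induce_neighborSet (G : SimpleGraph V) (v : V)
    (u : G.neighborSet v) :
    ((G.induce (G.neighborSet v)).neighborSet u).ncard = (G.commonNeighbors v u).ncard := by
  rw [← Set.ncard_image_of_injective _ Subtype.val_injective]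
  congr 1
  ext w
  simp [mem_commonNeighbors, and_comm]

theorem mul_card_le_two_mul_ncard_edgeSet [Finite V] {G : SimpleGraph V} {c : ℕ}
    (h : ∀ v, c ≤ (G.neighborSet v).ncard) : c * Nat.card V ≤ 2 * G.edgeSet.ncard := by
  have := Fintype.ofFinite V
  have := Finset.card_nsmul_le_sum Finset.univ _ c fun v _ => h v
  rwa [sum_ncard_neighborSet, Finset.card_univ, ← Nat.card_eq_fintype_card, smul_eq_mul,
    mul_comm] at this

theorem isMinor_top_fin_succ_of_le_ncard_edgeSet {c k : ℕ} (hc : 2 ≤ c)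
    (hlocal : ∀ {W : Type u} [Finite W] (F : SimpleGraph W), c < Nat.card W →
      Nat.card W < 2 * c → (∀ w, c ≤ (F.neighborSet w).ncard) →
      IsMinor (⊤ : SimpleGraph (Fin k)) F)
    {V : Type u} [Finite V] (G : SimpleGraph V) (hV : 2 ≤ Nat.card V)
    (hE : c * Nat.card V ≤ G.edgeSet.ncard + c) :
    IsMinor (⊤ : SimpleGraph (Fin (k + 1))) G := by
  obtain ⟨n, hn⟩ := Nat.exists_eq_add_of_le' hV
  induction n generalizing V with
  | zero =>
    have hle := ncard_edgeSet_le_choose_two G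
    rw [hn, zero_add, Nat.choose_self] at hle
    rw [hn] at hE
    lia
  | succ n ih =>
    have hm : c * (n + 2) ≤ G.edgeSet.ncard := by
      rw [hn] at hE
      linarith
    obtain ⟨G', hG', hE'⟩ := exists_le_ncard_edgeSet_eq G hm
    refine IsMinor.trans ?_ (.of_isContained (.of_le hG'))
    obtain ⟨v, hv⟩ : ∃ v, (G'.neighborSet v).ncard < 2 * c := by
      by_contra! hdeg
      have := mul_card_le_two_mul_ncard_edgeSet hdeg
      rw [hE', hn] at this
      linarith
    rcases exists_isMinor_or_le_ncard_commonNeighbors G' c v with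
      ⟨u, H, hH, hEH⟩ | ⟨hdeg, hcommon⟩
    · have hcard : Nat.card ({u}ᶜ : Set V) = n + 2 := by
        have := Set.ncard_add_ncard_compl {u}
        rw [Set.ncard_singleton, hn] at this
        rw [Nat.card_coe_set_eq]
        lia
      exact (ih H (by lia) (by rw [hcard]; lia) hcard).trans hH
    · refine isMinor_top_fin_succ (hlocal _ hdeg hv fun u => ?_)
      rw [ncard_neighborSet_induce_neighborSet]
      exact hcommon u u.2

theorem eq_top_of_le_ncard_neighborSet [Finite V] {G : SimpleGraph V}
    (h : ∀ v, Nat.card V ≤ (G.neighborSet v).ncard + 1) : G = ⊤ := by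
  refine eq_top_iff.2 fun v w hvw => ?_
  by_contra hw
  have hdisj : Disjoint (G.neighborSet v) {v, w} := by
    simp [Set.disjoint_insert_right, hw]
  have := Set.ncard_union_eq hdisj
  have := Set.ncard_pair hvw.ne
  have := Set.ncard_le_card (G.neighborSet v ∪ {v, w})
  have := h v
  lia

theorem isMinor_top_fin_four_of_le_ncard_edgeSet {V : Type u} [Finite V] (G : SimpleGraph V)
    (hV : 2 ≤ Nat.card V) (hE : 2 * Nat.card V ≤ G.edgeSet.ncard + 2) :
    IsMinor (⊤ : SimpleGraph (Fin 4)) G := by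
  refine isMinor_top_fin_succ_of_le_ncard_edgeSet le_rfl (fun {W} _ F h₁ h₂ hdeg => ?_) G hV hE
  have hcard : Nat.card W = 3 := by lia
  obtain rfl : F = ⊤ := eq_top_of_le_ncard_neighborSet fun w => by
    rw [hcard]
    exact Nat.succ_le_succ (hdeg w)
  exact .of_isContained (Iso.completeGraph (Finite.equivFinOfCardEq hcard).symm).isContained

theorem isMinor_top_fin_five_of_le_ncard_edgeSet {V : Type u} [Finite V] (G : SimpleGraph V)
    (hV : 2 ≤ Nat.card V) (hE : 3 * Nat.card V ≤ G.edgeSet.ncard + 3) :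
    IsMinor (⊤ : SimpleGraph (Fin 5)) G := by
  refine isMinor_top_fin_succ_of_le_ncard_edgeSet (by simp) (fun {W} _ F h₁ h₂ hdeg => ?_) G hV hE
  have := mul_card_le_two_mul_ncard_edgeSet hdeg
  exact isMinor_top_fin_four_of_le_ncard_edgeSet F (by lia) (by lia)

end Extremal

section Density

theorem sum_numSpanningTreesThrough [Fintype V] (G : SimpleGraph V) [Fintype G.edgeSet] :
    ∑ e ∈ G.edgeFinset, G.numSpanningTreesThrough e =
      (Fintype.card V - 1) * G.numSpanningTrees := by
  classical
  have hcount := Finset.sum_card_bipartiteAbove_eq_sum_card_bipartiteBelow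
    (s := G.edgeFinset) (t := G.spanningTrees.toFinset) fun e T => e ∈ T.edgeSet
  have habove (e : Sym2 V) : (G.spanningTrees.toFinset.bipartiteAbove
      (fun e T => e ∈ T.edgeSet) e).card = G.numSpanningTreesThrough e := by
    rw [numSpanningTreesThrough, ← Set.ncard_coe_finset]
    congr 1
    ext T
    simp [spanningTreesThrough, Finset.bipartiteAbove]
  have hbelow (T) (hT : T ∈ G.spanningTrees.toFinset) : (G.edgeFinset.bipartiteBelow
      (fun e T => e ∈ T.edgeSet) T).card = Fintype.card V - 1 := by
    obtain ⟨hTG, hT⟩ := Set.mem_toFinset.1 hT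
    rw [← hT.card_edgeFinset, Nat.add_sub_cancel]
    congr 1
    ext e
    simpa [Finset.bipartiteBelow] using fun he => edgeSet_mono hTG he
  simp_rw [habove] at hcount
  rw [hcount, Finset.sum_congr rfl hbelow, Finset.sum_const, smul_eq_mul, mul_comm,
    numSpanningTrees, Set.ncard_eq_toFinset_card']

theorem numSpanningTrees_pos [Finite V] {G : SimpleGraph V} (hG : G.Connected) :
    0 < G.numSpanningTrees := by
  obtain ⟨T, hT⟩ := hG.exists_isTree_le
  exact (Set.ncard_pos (Set.toFinite _)).2 ⟨T, hT⟩

theorem card_sub_one_le_ncard_edgeSet_mul_dep [Fintype V] {G : SimpleGraph V}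
    (hG : G.Connected) : (Fintype.card V - 1 : ℕ) ≤ G.edgeSet.ncard * G.dep := by
  classical
  have hpos : (0 : ℝ) < G.numSpanningTrees := mod_cast numSpanningTrees_pos hG
  refine le_of_mul_le_mul_right ?_ hpos
  calc ((Fintype.card V - 1 : ℕ) : ℝ) * G.numSpanningTrees
      = ∑ e ∈ G.edgeFinset, (G.numSpanningTreesThrough e : ℝ) := by
        exact_mod_cast (sum_numSpanningTreesThrough G).symm
    _ ≤ ∑ _e ∈ G.edgeFinset, G.dep * G.numSpanningTrees := by
        refine Finset.sum_le_sum fun e he => (div_le_iff₀ hpos).1 ?_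
        have he := mem_edgeFinset.1 he
        exact (G.isGreatest_dep ⟨e, he⟩).2 ⟨e, he, rfl⟩
    _ = G.edgeSet.ncard * G.dep * G.numSpanningTrees := by
        rw [Finset.sum_const, nsmul_eq_mul, ← Set.ncard_coe_finset, coe_edgeFinset, mul_assoc]

theorem one_third_lt_dep_of_not_isMinor [Fintype V] {G : SimpleGraph V}
    (hV : 2 ≤ Fintype.card V) (hG : G.Connected)
    (hK₅ : ¬ IsMinor (⊤ : SimpleGraph (Fin 5)) G) : 1 / 3 < G.dep := by
  by_contra! hdep
  have hle : ((Fintype.card V - 1 : ℕ) : ℝ) ≤ G.edgeSet.ncard * (1 / 3) :=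
    (card_sub_one_le_ncard_edgeSet_mul_dep hG).trans (by gcongr)
  have hE : 3 * (Fintype.card V - 1) ≤ G.edgeSet.ncard := by
    rw [← Nat.cast_le (α := ℝ)]
    push_cast
    linarith
  rw [← Nat.card_eq_fintype_card] at hV hE
  exact hK₅ (isMinor_top_fin_five_of_le_ncard_edgeSet G hV (by lia))

theorem one_third_lt_dep_of_isPlanar [Fintype V] {G : SimpleGraph V}
    (hV : 2 ≤ Fintype.card V) (hG : G.Connected) (hplanar : G.IsPlanar) : 1 / 3 < G.dep :=
  one_third_lt_dep_of_not_isMinor hV hG (not_isMinor_top_fin_five_of_isPlanar hplanar)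

theorem one_third_lt_of_isPlanarDependence {r : ℝ} (hr : IsPlanarDependence.{u} r) :
    1 / 3 < r := by
  obtain ⟨V, _, G, hV, hG, hplanar, rfl⟩ := hr
  exact one_third_lt_dep_of_isPlanar hV hG hplanar

end Density

end SpanningTreeDependence

theorem theorem3 :
    (∀ (V : Type u) [Fintype V] (G : SimpleGraph V),
      2 ≤ Fintype.card V → G.Connected → G.IsPlanar → 1 / 3 < G.dep) ∧
    (∀ r : ℚ, r ≤ 1 / 3 → ¬ IsPlanarDependence.{u} (r : ℝ)) ∧
    ¬ (∀ p q : ℕ, 0 < p → p < q → IsPlanarDependence.{u} ((p : ℝ) / (q : ℝ))) := by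
  refine ⟨fun V _ G => SpanningTreeDependence.one_third_lt_dep_of_isPlanar, fun r hr hdep => ?_,
    fun hKahl => ?_⟩
  · have : 1 / 3 < (r : ℝ) := SpanningTreeDependence.one_third_lt_of_isPlanarDependence hdep
    have : (r : ℝ) ≤ (1 / 3 : ℚ) := Rat.cast_le.2 hr
    push_cast at this
    linarith
  · have := SpanningTreeDependence.one_third_lt_of_isPlanarDependence
      (hKahl 1 3 one_pos (by norm_num))
    norm_num at this
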